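/- Let $f:[0,\infty)\to\mathbb R$ be a standard operator monotone function: $0\le A\le B$ implies $f(A)\le f(B)$ for Hermitian matrices of every size, $f(x)=x f(1/x)$ for all $x>0$, $f(1)=1$, and $f(0)=\lim_{x\downarrow 0}f(x)$. For a state (density matrix) $\rho$ and an observable (Hermitian matrix) $H$ of a finite-dimensional system, the skew information is $$I^f(\rho,H)=\frac{f(0)}{2}\operatorname{Tr}\Big[(i[H,\rho])\,c_f(L_\rho,R_\rho)\big(i[H,\rho]\big)\Big],\qquad c_f(x,y)=\frac{1}{y f(x/y)},$$ where $L_\rho X=\rho X$, $R_\rho X=X\rho$ and $c_f(x,0)=\frac{1}{x f(0)}$ for $x>0$ by continuity. The component of $[H,\rho]$ belonging to the eigenvalue pair $(0,0)$ vanishes and contributes $0$, and $I^f=0$ if $f(0)=0$. Equivalently, for $\rho=\sum_j\lambda_j|j\rangle\langle j|$, $I^f(\rho,H)=\frac{f(0)}2\sum_{i,j}(\lambda_i-\lambda_j)^2c_f(\lambda_i,\lambda_j)\,|\langle i|H|j\rangle|^2$. Then for every state $\rho_{12}$ of a bipartite finite-dimensional system, with reduced state $\rho_1=\operatorname{Tr}_2\rho_{12}$,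 and all observables $H_1,H_2$ of the two subsystems, $$I^f(\rho_{12},\,H_1\otimes \mathbb I+\mathbb I\otimes H_2)\ \ge\ I^f(\rho_1,H_1),$$ and in particular $$I^f(\rho_{12},\,H_1\otimes \mathbb I)\ \ge\ I^f(\rho_1,H_1).$$ Moreover, the partial trace is covariant: with $H_{12}=H_1\otimes \mathbb I+\mathbb I\otimes H_2$, for all $t\in\mathbb R$ and all operators $X$ on the bipartite system, $$\operatorname{Tr}_2\big[e^{-iH_{12}t}Xe^{iH_{12}t}\big]=e^{-iH_1t}\operatorname{Tr}_2[X]\,e^{iH_1t}.$$ -/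

import Mathlib

open scoped Matrix Kronecker ComplexOrder

/-- A quantum state of a finite-dimensional system with orthonormal basis indexed by `n`:
a positive semidefinite matrix of trace one. -/
structure QState (n : Type*) [Fintype n] where
  mat : Matrix n n ℂ
  posSemidef : mat.PosSemidef
  trace_eq_one : mat.trace = 1

/-- The partial trace over the second factor, `Tr₂ : M_{n × m} → M_n`. -/
def partialTrace₂ {n m : Type*} [Fintype m] (X : Matrix (n × m) (n × m) ℂ) : Matrix n n ℂ :=
  Matrix.of fun i j => ∑ k, X (i, k) (j, k)

theorem partialTrace₂_eq_sum {n m : Type*} [Fintype m] (X : Matrix (n × m) (n × m) ℂ) :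
    partialTrace₂ X = ∑ k, X.submatrix (fun i => (i, k)) (fun i => (i, k)) := by
  ext i j
  simp [partialTrace₂, Matrix.sum_apply]

/-- The reduced state `ρ₁ = Tr₂ ρ₁₂` on the first subsystem of a bipartite state. -/
def QState.reduced₁ {n m : Type*} [Fintype n] [Fintype m] (ρ : QState (n × m)) : QState n where
  mat := partialTrace₂ ρ.mat
  posSemidef := by
    rw [partialTrace₂_eq_sum]
    exact Matrix.posSemidef_sum _ fun k _ => ρ.posSemidef.submatrix _
  trace_eq_one := by
    rw [← ρ.trace_eq_one]
    simp [partialTrace₂, Matrix.trace, Fintype.sum_prod_type]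

/-- Standard operator monotone functions. Only the values of `f` on `[0, ∞)` matter; as usual
`f 0` is the limit of `f x` as `x` decreases to `0`. -/
structure IsStandardOperatorMonotone (f : ℝ → ℝ) : Prop where
  /-- `0 ≤ A ≤ B` implies `f(A) ≤ f(B)`, for Hermitian matrices of every size. -/
  monotone : ∀ (k : ℕ) (A B : Matrix (Fin k) (Fin k) ℂ),
    A.PosSemidef → (B - A).PosSemidef → (cfc f B - cfc f A).PosSemidef
  symm : ∀ x : ℝ, 0 < x → f x = x * f (1 / x)
  map_one : f 1 = 1
  continuous_zero : ContinuousWithinAt f (Set.Ici 0) 0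

/-- The Morozova-Chentsov function `c_f(x, y) = 1 / (y f(x / y))` on `[0, ∞)²`. For `y = 0 < x`
it is the continuous extension `1 / (x f(0))`, since `y f(x / y) = x f(y / x)`. The
value at `(0, 0)` is immaterial: it is only applied to matrices without such a component. -/
noncomputable def morozovaChentsov (f : ℝ → ℝ) (x y : ℝ) : ℝ :=
  if y = 0 then (x * f 0)⁻¹ else (y * f (x / y))⁻¹

/-- The superoperator `c(L_ρ, R_ρ)` (joint functional calculus of the commuting operators
`L_ρ X = ρ X` and `R_ρ X = X ρ`): if `ρ = ∑ λ_i |i⟩⟨i|`, then `|i⟩⟨j|` is a joint eigenvector of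
`L_ρ`, `R_ρ` with eigenvalues `λ_i`, `λ_j`, and `c(L_ρ, R_ρ)` multiplies it by `c(λ_i, λ_j)`. -/
noncomputable def leftRightCalculus {n : Type*} [Fintype n] [DecidableEq n]
    {ρ : Matrix n n ℂ} (hρ : ρ.IsHermitian) (c : ℝ → ℝ → ℝ) (X : Matrix n n ℂ) :
    Matrix n n ℂ :=
  let U : Matrix n n ℂ := hρ.eigenvectorUnitary
  U * (Matrix.of fun i j =>
    (c (hρ.eigenvalues i) (hρ.eigenvalues j) : ℂ) * (Uᴴ * X * U) i j) * Uᴴ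

/-- The (metric-adjusted) skew information
`I^f(ρ, H) = (f(0) / 2) Tr[(i[H, ρ]) c_f(L_ρ, R_ρ)(i[H, ρ])]`. The trace is a real number. -/
noncomputable def skewInformation {n : Type*} [Fintype n] [DecidableEq n]
    (f : ℝ → ℝ) (ρ : QState n) (H : Matrix n n ℂ) : ℝ :=
  let D : Matrix n n ℂ := Complex.I • (H * ρ.mat - ρ.mat * H)
  f 0 / 2 *
    (D * leftRightCalculus ρ.posSemidef.isHermitian (morozovaChentsov f) D).trace.re

/-!
The skew information is the quadratic form of the monotone metric with kernel `c_f` at the tangent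
vector `i[H, ρ]`, and the partial trace maps `[H₁ ⊗ 1 + 1 ⊗ H₂, ρ₁₂]` to `[H₁, ρ₁]`, because it is
cyclic for operators on the second factor (`partialTrace₂_commutator`). The inequality is therefore
Petz's monotonicity of the metric under the partial trace. The covariance statement rests on the
same cyclicity and on `exp (A ⊗ 1 + 1 ⊗ B) = exp A ⊗ exp B`.

Monotonicity of the metric comes from the operator Jensen inequality `V* f(A) V ≤ f(V* A V)` for
isometries `V` (`IsStandardOperatorMonotone.jensen`). Let `S X = X ⊗ 1` be the adjoint of the
partial trace, written in eigenbases of `ρ₁₂` and `ρ₁`. It satisfies `S* L_ρ₁₂ S = L_ρ₁` and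
`S* R_ρ₁₂ S = R_ρ₁`. Jensen's inequality for the isometry `R_ρ₁₂^{1/2} S R_ρ₁^{-1/2}` and the
operator `L_ρ₁₂ R_ρ₁₂⁻¹` gives `S* J₁₂ S ≤ J₁` for the means `J = R f(L R⁻¹)`
(`IsStandardOperatorMonotone.sum_mean_le`). Taking inverses turns this into `S J₁⁻¹ S* ≤ J₁₂⁻¹`
(`Matrix.sum_inv_conjTranspose_mulVec_le`), where `J⁻¹ = c_f(L, R)` and `S*` is the partial trace.

This argument requires positive definite matrices. A singular state is treated by adding `ε` to it
and letting `ε` tend to `0`: the commutators do not change, and they have no component at the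
eigenvalue pair `(0, 0)`, the only place where `c_f` fails to converge when `f 0 > 0`. If `f 0 = 0`,
both sides vanish.
-/

open Filter Topology

/-! ### Functional calculus of matrices by interpolation -/

theorem exists_polynomial_eqOn_of_finite (f : ℝ → ℝ) {s : Set ℝ} (hs : s.Finite) :
    ∃ p : Polynomial ℝ, s.EqOn f p.eval := by
  classical
  refine ⟨Lagrange.interpolate hs.toFinset id f, fun x hx => ?_⟩
  exact (Lagrange.eval_interpolate_at_node (v := id) f Function.injective_id.injOn
    (hs.mem_toFinset.2 hx)).symm

theorem Matrix.IsHermitian.cfc_eq_aeval {ι : Type*} [Fintype ι] [DecidableEq ι]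
    {A : Matrix ι ι ℂ} (hA : A.IsHermitian) {f : ℝ → ℝ} {p : Polynomial ℝ}
    (h : (spectrum ℝ A).EqOn f p.eval) : cfc f A = Polynomial.aeval A p := by
  rw [cfc_congr h]
  exact cfc_polynomial p A hA.isSelfAdjoint

theorem Polynomial.aeval_matrix_mul_of_mul_eq {ι κ : Type*} [Fintype ι] [DecidableEq ι]
    [Fintype κ] [DecidableEq κ] {A : Matrix ι ι ℂ} {B : Matrix κ κ ℂ} {V : Matrix ι κ ℂ}
    (h : A * V = V * B) (p : Polynomial ℝ) :
    Polynomial.aeval A p * V = V * Polynomial.aeval B p := by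
  induction p using Polynomial.induction_on' with
  | add p q hp hq => simp [Matrix.add_mul, Matrix.mul_add, hp, hq]
  | monomial k c =>
    have hk : A ^ k * V = V * B ^ k := by
      induction k with
      | zero => simp
      | succ k ih => rw [pow_succ, pow_succ, Matrix.mul_assoc, h, ← Matrix.mul_assoc, ih,
          Matrix.mul_assoc]
    simp [Polynomial.aeval_monomial, Algebra.algebraMap_eq_smul_one, hk]

/-- Functional calculus respects intertwiners: on the two finite spectra `f` agrees with a single
polynomial. -/
theorem Matrix.cfc_mul_of_mul_eq {ι κ : Type*} [Fintype ι] [DecidableEq ι]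
    [Fintype κ] [DecidableEq κ] {A : Matrix ι ι ℂ} {B : Matrix κ κ ℂ} {V : Matrix ι κ ℂ}
    (hA : A.IsHermitian) (hB : B.IsHermitian) (h : A * V = V * B) (f : ℝ → ℝ) :
    cfc f A * V = V * cfc f B := by
  obtain ⟨p, hp⟩ := exists_polynomial_eqOn_of_finite f
    ((Matrix.finite_real_spectrum (A := A)).union (Matrix.finite_real_spectrum (A := B)))
  rw [hA.cfc_eq_aeval (hp.mono Set.subset_union_left),
    hB.cfc_eq_aeval (hp.mono Set.subset_union_right)]
  exact Polynomial.aeval_matrix_mul_of_mul_eq h p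

theorem Matrix.isHermitian_diagonal_ofReal {ι : Type*} [DecidableEq ι]
    (a : ι → ℝ) : (Matrix.diagonal fun i => (a i : ℂ)).IsHermitian :=
  Matrix.isHermitian_diagonal_of_self_adjoint _ (by ext i; simp)

/-- Functional calculus acts entrywise on real diagonal matrices. -/
theorem Matrix.cfc_diagonal_ofReal {ι : Type*} [Fintype ι] [DecidableEq ι] (f : ℝ → ℝ)
    (a : ι → ℝ) :
    cfc f (Matrix.diagonal fun i => (a i : ℂ)) = Matrix.diagonal fun i => (f (a i) : ℂ) := by
  have hA := Matrix.isHermitian_diagonal_ofReal a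
  obtain ⟨p, hp⟩ := exists_polynomial_eqOn_of_finite f
    ((Matrix.finite_real_spectrum (A := Matrix.diagonal fun i => (a i : ℂ))).union
      (Set.finite_range a))
  rw [hA.cfc_eq_aeval (hp.mono Set.subset_union_left)]
  have h2 : ∀ i, f (a i) = p.eval (a i) := fun i => hp (Or.inr ⟨i, rfl⟩)
  simp_rw [h2]
  clear h2 hp
  induction p using Polynomial.induction_on' with
  | add p q hp hq => simp [hp, hq]
  | monomial k c =>
    simp only [Polynomial.aeval_monomial, Polynomial.eval_monomial, Matrix.diagonal_pow,
      Algebra.algebraMap_eq_smul_one]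
    ext i j
    by_cases hij : i = j <;> simp [hij, Matrix.diagonal]

/-- Operator monotonicity over an arbitrary finite index type, transported from `Fin k` by a
permutation matrix. -/
theorem IsStandardOperatorMonotone.cfc_sub_cfc_posSemidef {f : ℝ → ℝ}
    (hf : IsStandardOperatorMonotone f) {ι : Type*} [Fintype ι] [DecidableEq ι]
    {A B : Matrix ι ι ℂ} (hA : A.PosSemidef) (hAB : (B - A).PosSemidef) :
    (cfc f B - cfc f A).PosSemidef := by
  let e := Fintype.equivFin ι
  have key : ∀ C : Matrix ι ι ℂ, C.IsHermitian →
      cfc f C = (cfc f (C.submatrix e.symm e.symm)).submatrix e e := by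
    intro C hC
    have h := Matrix.cfc_mul_of_mul_eq (V := (1 : Matrix ι ι ℂ).submatrix e.symm id)
      (hC.submatrix e.symm) hC (by
        have h1 := Matrix.mul_submatrix_one e.symm id (C.submatrix e.symm e.symm)
        have h2 := Matrix.one_submatrix_mul e.symm (Equiv.refl ι) C
        simp only [Equiv.coe_refl] at h2
        rw [h1, h2]
        ext i j
        simp) f
    ext i j
    have := congrFun (congrFun h (e i)) j
    simpa [Matrix.mul_apply, Matrix.one_apply, Equiv.symm_apply_eq] using this.symm
  have hB : B.IsHermitian := by
    have := hAB.isHermitian.add hA.isHermitian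
    rwa [sub_add_cancel] at this
  rw [key A hA.isHermitian, key B hB]
  exact (hf.monotone _ _ _ (hA.submatrix e.symm)
    (by simpa [Matrix.submatrix_sub] using hAB.submatrix e.symm)).submatrix e

/-! ### Scalar properties of standard operator monotone functions -/

namespace IsStandardOperatorMonotone

variable {f : ℝ → ℝ}

theorem monotoneOn (hf : IsStandardOperatorMonotone f) {x y : ℝ} (hx : 0 ≤ x) (hxy : x ≤ y) :
    f x ≤ f y := by
  have h := hf.cfc_sub_cfc_posSemidef (ι := Unit)
    (A := Matrix.diagonal fun _ => (x : ℂ)) (B := Matrix.diagonal fun _ => (y : ℂ))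
    (Matrix.PosSemidef.diagonal fun _ => by simpa using hx)
    (by
      rw [Matrix.diagonal_sub]
      exact Matrix.PosSemidef.diagonal fun _ => by
        simpa [← Complex.ofReal_sub] using hxy)
  rw [Matrix.cfc_diagonal_ofReal f fun _ => x, Matrix.cfc_diagonal_ofReal f fun _ => y,
    Matrix.diagonal_sub] at h
  have := h.diag_nonneg (i := ())
  simpa [← Complex.ofReal_sub] using this

theorem pos (hf : IsStandardOperatorMonotone f) {x : ℝ} (hx : 0 < x) : 0 < f x := by
  rcases le_total x 1 with h | h
  · rw [hf.symm x hx]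
    have := hf.monotoneOn zero_le_one ((one_le_div hx).2 h)
    rw [hf.map_one] at this
    positivity
  · have := hf.monotoneOn zero_le_one h
    rw [hf.map_one] at this
    linarith

/-- The symmetry of `f` turns its monotonicity into `f (s x) ≤ s f x` for `s ≥ 1`. -/
theorem map_mul_le (hf : IsStandardOperatorMonotone f) {s x : ℝ} (hs : 1 ≤ s) (hx : 0 < x) :
    f (s * x) ≤ s * f x := by
  have hs0 : 0 < s := by linarith
  rw [hf.symm _ (mul_pos hs0 hx), hf.symm x hx, mul_assoc]
  have : f (1 / (s * x)) ≤ f (1 / x) :=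
    hf.monotoneOn (by positivity) (one_div_le_one_div_of_le hx (by nlinarith))
  gcongr

theorem map_zero_nonneg (hf : IsStandardOperatorMonotone f) : 0 ≤ f 0 := by
  have h : Tendsto f (𝓝[>] 0) (𝓝 (f 0)) :=
    hf.continuous_zero.mono_left (nhdsWithin_mono _ Set.Ioi_subset_Ici_self)
  exact ge_of_tendsto h (eventually_nhdsWithin_of_forall fun x hx => (hf.pos hx).le)

/-- Continuity on `[0, ∞)`. At positive points it follows from `f` being increasing and `f x / x`
being decreasing. -/
theorem continuousWithinAt (hf : IsStandardOperatorMonotone f) {x : ℝ} (hx : 0 ≤ x) :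
    ContinuousWithinAt f (Set.Ici 0) x := by
  rcases hx.eq_or_lt with rfl | hx
  · exact hf.continuous_zero
  refine ContinuousAt.continuousWithinAt ?_
  -- `f y` lies between `f x` and `(y / x) f x`
  have h1 : Tendsto (fun y => min (f x) (y / x * f x)) (𝓝 x) (𝓝 (f x)) := by
    have : ContinuousAt (fun y => min (f x) (y / x * f x)) x := by fun_prop
    simpa [ContinuousAt, div_self hx.ne'] using this
  have h2 : Tendsto (fun y => max (f x) (y / x * f x)) (𝓝 x) (𝓝 (f x)) := by
    have : ContinuousAt (fun y => max (f x) (y / x * f x)) x := by fun_prop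
    simpa [ContinuousAt, div_self hx.ne'] using this
  refine tendsto_of_tendsto_of_tendsto_of_le_of_le' h1 h2 ?_ ?_ <;>
    filter_upwards [lt_mem_nhds hx] with y hy
  · rcases le_total x y with h | h
    · exact (min_le_left _ _).trans (hf.monotoneOn hx.le h)
    · refine (min_le_right _ _).trans ?_
      have := hf.map_mul_le ((one_le_div hy).2 h) hy
      rw [div_mul_cancel₀ _ hy.ne'] at this
      calc y / x * f x ≤ y / x * (x / y * f y) := by gcongr
        _ = f y := by field_simp
  · rcases le_total x y with h | h
    · refine le_trans ?_ (le_max_right _ _)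
      have := hf.map_mul_le ((one_le_div hx).2 h) hx
      rwa [div_mul_cancel₀ _ hx.ne'] at this
    · exact (hf.monotoneOn hy.le h).trans (le_max_left _ _)

end IsStandardOperatorMonotone

/-! ### Operator Jensen inequality -/

theorem Matrix.star_dotProduct_diagonal_ofReal_mulVec {ι : Type*} [Fintype ι] [DecidableEq ι]
    (d : ι → ℝ) (x : ι → ℂ) :
    star x ⬝ᵥ ((Matrix.diagonal fun i => (d i : ℂ)) *ᵥ x) = (∑ i, d i * ‖x i‖ ^ 2 : ℝ) := by
  simp only [dotProduct, Matrix.mulVec_diagonal, Pi.star_apply, Complex.ofReal_sum]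
  refine Finset.sum_congr rfl fun i _ => ?_
  have := Complex.conj_mul' (x i)
  push_cast
  rw [← this, Complex.star_def]
  ring

theorem Matrix.star_dotProduct_conjTranspose_mul_mul_mulVec {ι κ : Type*} [Fintype ι]
    [Fintype κ] (V : Matrix ι κ ℂ) (A : Matrix ι ι ℂ) (y : κ → ℂ) :
    star y ⬝ᵥ ((Vᴴ * A * V) *ᵥ y) = star (V *ᵥ y) ⬝ᵥ (A *ᵥ (V *ᵥ y)) := by
  rw [Matrix.star_mulVec, ← Matrix.dotProduct_mulVec, Matrix.mulVec_mulVec, Matrix.mulVec_mulVec,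
    Matrix.mul_assoc]

/-- A positive semidefinite `A ≤ M` is dominated by a matrix that is block diagonal for the
complementary projections `P` and `1 - P`, with `P`-block arbitrarily close to that of `A`; the
price is a large block on the range of `1 - P`. -/
theorem Matrix.PosSemidef.pinching_sub {ι : Type*} [Fintype ι] [DecidableEq ι]
    {A P : Matrix ι ι ℂ} (hA : A.PosSemidef) (hP : P.IsHermitian) (hPP : P * P = P) {M : ℝ}
    (hM : ((M : ℂ) • (1 : Matrix ι ι ℂ) - A).PosSemidef) {δ : ℝ} (hδ : 0 < δ) :
    ((((1 + δ : ℝ) : ℂ) • (P * A * P) + (((1 + δ⁻¹) * M : ℝ) : ℂ) • (1 - P)) - A).PosSemidef := by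
  obtain ⟨Q, hQ⟩ : ∃ Q, Q = 1 - P := ⟨_, rfl⟩
  have hQh : Qᴴ = Q := by rw [hQ]; exact Matrix.isHermitian_one.sub hP
  have hQQ : Q * Q = Q := by rw [hQ]; simp [sub_mul, mul_sub, hPP]
  have hAPQ : A = P * A * P + P * A * Q + Q * A * P + Q * A * Q := by rw [hQ]; noncomm_ring
  have hδ' : (δ : ℂ) ≠ 0 := by exact_mod_cast hδ.ne'
  -- completing the square for the off-diagonal blocks of `A`
  have key : (((1 + δ : ℝ) : ℂ) • (P * A * P) + (((1 + δ⁻¹) * M : ℝ) : ℂ) • (1 - P)) - A =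
      ((δ⁻¹ : ℝ) : ℂ) • (((δ : ℂ) • P - Q) * A * ((δ : ℂ) • P - Q)ᴴ) +
        ((1 + δ⁻¹ : ℝ) : ℂ) • (Q * ((M : ℂ) • (1 : Matrix ι ι ℂ) - A) * Qᴴ) := by
    have h1 : ((δ : ℂ) • P - Q)ᴴ = (δ : ℂ) • P - Q := by
      rw [Matrix.conjTranspose_sub, Matrix.conjTranspose_smul, hP.eq, hQh]; simp
    rw [h1, hQh, ← hQ]
    simp only [sub_mul, mul_sub, Matrix.smul_mul, Matrix.mul_smul, Matrix.mul_one, hQQ]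
    conv_lhs => rw [sub_eq_add_neg, hAPQ]
    have hsub : P * (P * A * P + P * A * Q + Q * A * P + Q * A * Q) * P = P * A * P := by
      rw [← hAPQ]
    rw [hsub]
    push_cast
    match_scalars <;> field_simp <;> ring
  rw [key]
  refine ((hA.mul_mul_conjTranspose_same _).smul ?_).add
    ((hM.mul_mul_conjTranspose_same _).smul ?_)
  · exact_mod_cast (inv_pos.2 hδ).le
  · have : 0 ≤ 1 + δ⁻¹ := by positivity
    exact_mod_cast this

/-- The operator Jensen inequality `V* f(A) V ≤ f(V* A V)` for an isometry `V`, in bases in which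
`A` and `V* A V` are diagonal. The matrix `A` lies below a matrix `B` which leaves the range of `V`
invariant and acts there as `(1 + δ) V* A V`. Hence `V* f(A) V ≤ V* f(B) V = f((1 + δ) V* A V)`, and
this is at most `(1 + δ) f(V* A V)`. -/
theorem IsStandardOperatorMonotone.jensen {f : ℝ → ℝ} (hf : IsStandardOperatorMonotone f)
    {ι κ : Type*} [Fintype ι] [DecidableEq ι] [Fintype κ] [DecidableEq κ]
    {a : ι → ℝ} {b : κ → ℝ} (ha : ∀ i, 0 ≤ a i) (hb : ∀ j, 0 < b j) {V : Matrix ι κ ℂ}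
    (hV : Vᴴ * V = 1)
    (hab : Vᴴ * (Matrix.diagonal fun i => (a i : ℂ)) * V = Matrix.diagonal fun j => (b j : ℂ))
    (y : κ → ℂ) :
    ∑ i, f (a i) * ‖(V *ᵥ y) i‖ ^ 2 ≤ ∑ j, f (b j) * ‖y j‖ ^ 2 := by
  set A : Matrix ι ι ℂ := Matrix.diagonal fun i => (a i : ℂ) with hA
  have hApos : A.PosSemidef := Matrix.PosSemidef.diagonal fun i => by simpa using ha i
  obtain ⟨M, hM⟩ : ∃ M : ℝ, ∀ i, a i ≤ M :=
    ⟨∑ i, a i, fun i => Finset.single_le_sum (fun j _ => ha j) (Finset.mem_univ i)⟩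
  have hMA : ((M : ℂ) • (1 : Matrix ι ι ℂ) - A).PosSemidef := by
    rw [Matrix.smul_one_eq_diagonal, hA, Matrix.diagonal_sub]
    exact Matrix.PosSemidef.diagonal fun i => by
      simpa [← Complex.ofReal_sub] using hM i
  have hP : (V * Vᴴ).IsHermitian := Matrix.isHermitian_mul_conjTranspose_self V
  have hPP : V * Vᴴ * (V * Vᴴ) = V * Vᴴ := by
    rw [Matrix.mul_assoc, ← Matrix.mul_assoc Vᴴ, hV, Matrix.one_mul]
  have hδ : ∀ δ : ℝ, 0 < δ →
      ∑ i, f (a i) * ‖(V *ᵥ y) i‖ ^ 2 ≤ (1 + δ) * ∑ j, f (b j) * ‖y j‖ ^ 2 := by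
    intro δ hδ
    have hBA := hApos.pinching_sub hP hPP hMA hδ
    set B : Matrix ι ι ℂ := ((1 + δ : ℝ) : ℂ) • (V * Vᴴ * A * (V * Vᴴ)) +
      (((1 + δ⁻¹) * M : ℝ) : ℂ) • (1 - V * Vᴴ) with hB
    have hBh : B.IsHermitian := by
      have := hBA.isHermitian.add hApos.isHermitian
      rwa [sub_add_cancel] at this
    -- the range of `V` is an invariant subspace of `B`
    have hBV : B * V = V * Matrix.diagonal fun j => (((1 + δ) * b j : ℝ) : ℂ) := by
      have h1 : V * Vᴴ * A * (V * Vᴴ) * V = V * Matrix.diagonal fun j => (b j : ℂ) := by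
        rw [← hab]
        simp only [Matrix.mul_assoc, hV, Matrix.mul_one]
      have h2 : (1 - V * Vᴴ) * V = 0 := by
        rw [Matrix.sub_mul, Matrix.mul_assoc, hV]; simp
      rw [hB, Matrix.add_mul, Matrix.smul_mul, Matrix.smul_mul, h1, h2, smul_zero, add_zero,
        ← Matrix.mul_smul, ← Matrix.diagonal_smul]
      congr 2
      ext j
      simp
    have hfBV := Matrix.cfc_mul_of_mul_eq hBh (Matrix.isHermitian_diagonal_ofReal _) hBV f
    rw [Matrix.cfc_diagonal_ofReal] at hfBV
    have hfV : Vᴴ * cfc f B * V = Matrix.diagonal fun j => (f ((1 + δ) * b j) : ℂ) := by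
      rw [Matrix.mul_assoc, hfBV, ← Matrix.mul_assoc, hV, Matrix.one_mul]
    have h := ((hf.cfc_sub_cfc_posSemidef hApos hBA).conjTranspose_mul_mul_same V)
    have h := h.dotProduct_mulVec_nonneg y
    rw [Matrix.mul_sub, Matrix.sub_mul, hfV, hA, Matrix.cfc_diagonal_ofReal, Matrix.sub_mulVec,
      dotProduct_sub, Matrix.star_dotProduct_conjTranspose_mul_mul_mulVec,
      Matrix.star_dotProduct_diagonal_ofReal_mulVec,
      Matrix.star_dotProduct_diagonal_ofReal_mulVec, sub_nonneg] at h
    refine (Complex.real_le_real.1 h).trans ?_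
    rw [Finset.mul_sum]
    refine Finset.sum_le_sum fun j _ => ?_
    rw [← mul_assoc]
    have := hf.map_mul_le (s := 1 + δ) (by linarith) (hb j)
    gcongr
  have hlim : Tendsto (fun δ : ℝ => (1 + δ) * ∑ j, f (b j) * ‖y j‖ ^ 2) (𝓝[>] 0)
      (𝓝 (∑ j, f (b j) * ‖y j‖ ^ 2)) := by
    have : ContinuousAt (fun δ : ℝ => (1 + δ) * ∑ j, f (b j) * ‖y j‖ ^ 2) 0 := by fun_prop
    have h := this.tendsto
    simp only [add_zero, one_mul] at h
    exact h.mono_left nhdsWithin_le_nhds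
  exact ge_of_tendsto hlim (eventually_nhdsWithin_of_forall fun δ h => hδ δ h)

/-! ### Monotonicity of the quadratic forms -/

/-- Let `S` relate two pairs of commuting positive operators by
`S* diag(l) S = diag(l')` and `S* diag(r) S = diag(r')`. The means `r f(l / r)` then satisfy
`S* diag(r f(l / r)) S ≤ diag(r' f(l' / r'))`: apply Jensen's inequality to the isometry
`diag(r)^{1/2} S diag(r')^{-1/2}`. -/
theorem IsStandardOperatorMonotone.sum_mean_le {f : ℝ → ℝ} (hf : IsStandardOperatorMonotone f)
    {ι κ : Type*} [Fintype ι] [DecidableEq ι] [Fintype κ] [DecidableEq κ]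
    {l r : ι → ℝ} {l' r' : κ → ℝ} (hl : ∀ i, 0 < l i) (hr : ∀ i, 0 < r i)
    (hl' : ∀ j, 0 < l' j) (hr' : ∀ j, 0 < r' j) {S : Matrix ι κ ℂ}
    (hSl : Sᴴ * (Matrix.diagonal fun i => (l i : ℂ)) * S = Matrix.diagonal fun j => (l' j : ℂ))
    (hSr : Sᴴ * (Matrix.diagonal fun i => (r i : ℂ)) * S = Matrix.diagonal fun j => (r' j : ℂ))
    (y : κ → ℂ) :
    ∑ i, r i * f (l i / r i) * ‖(S *ᵥ y) i‖ ^ 2 ≤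
      ∑ j, r' j * f (l' j / r' j) * ‖y j‖ ^ 2 := by
  set R : Matrix ι ι ℂ := Matrix.diagonal fun i => ((√(r i) : ℝ) : ℂ) with hR
  set T : Matrix κ κ ℂ := Matrix.diagonal fun j => (((√(r' j))⁻¹ : ℝ) : ℂ) with hT
  have hRh : Rᴴ = R := Matrix.isHermitian_diagonal_ofReal _
  have hTh : Tᴴ = T := Matrix.isHermitian_diagonal_ofReal _
  have hs : ∀ i, √(r i) * √(r i) = r i := fun i => Real.mul_self_sqrt (hr i).le
  have hs' : ∀ j, √(r' j) * √(r' j) = r' j := fun j => Real.mul_self_sqrt (hr' j).le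
  have hpos' : ∀ j, 0 < √(r' j) := fun j => Real.sqrt_pos.2 (hr' j)
  have hpos : ∀ i, 0 < √(r i) := fun i => Real.sqrt_pos.2 (hr i)
  have hRR : R * R = Matrix.diagonal fun i => (r i : ℂ) := by
    rw [hR, Matrix.diagonal_mul_diagonal]
    congr 1; ext i; rw [← Complex.ofReal_mul, hs]
  have hV : (R * S * T)ᴴ * (R * S * T) = 1 := by
    have h1 : (R * S * T)ᴴ * (R * S * T) = T * (Sᴴ * (R * R) * S) * T := by
      simp only [Matrix.conjTranspose_mul, hRh, hTh, Matrix.mul_assoc]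
    rw [h1, hRR, hSr, hT, Matrix.diagonal_mul_diagonal, Matrix.diagonal_mul_diagonal,
      ← Matrix.diagonal_one]
    congr 1; ext j
    rw [← Complex.ofReal_mul, ← Complex.ofReal_mul, ← Complex.ofReal_one]
    congr 1
    have := (hpos' j).ne'
    nth_rw 2 [← hs' j]
    field_simp
  have hab : (R * S * T)ᴴ * (Matrix.diagonal fun i => ((l i / r i : ℝ) : ℂ)) * (R * S * T) =
      Matrix.diagonal fun j => ((l' j / r' j : ℝ) : ℂ) := by
    have h1 : (R * S * T)ᴴ * (Matrix.diagonal fun i => ((l i / r i : ℝ) : ℂ)) * (R * S * T) =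
        T * (Sᴴ * (R * (Matrix.diagonal fun i => ((l i / r i : ℝ) : ℂ)) * R) * S) * T := by
      simp only [Matrix.conjTranspose_mul, hRh, hTh, Matrix.mul_assoc]
    have h2 : R * (Matrix.diagonal fun i => ((l i / r i : ℝ) : ℂ)) * R =
        Matrix.diagonal fun i => (l i : ℂ) := by
      rw [hR, Matrix.diagonal_mul_diagonal, Matrix.diagonal_mul_diagonal]
      congr 1; ext i
      rw [← Complex.ofReal_mul, ← Complex.ofReal_mul]
      congr 1
      have := (hpos i).ne'
      nth_rw 2 [← hs i]
      field_simp
    rw [h1, h2, hSl, hT, Matrix.diagonal_mul_diagonal, Matrix.diagonal_mul_diagonal]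
    congr 1; ext j
    rw [← Complex.ofReal_mul, ← Complex.ofReal_mul]
    congr 1
    have := (hpos' j).ne'
    nth_rw 3 [← hs' j]
    field_simp
  have h := hf.jensen (fun i => (div_pos (hl i) (hr i)).le)
    (fun j => div_pos (hl' j) (hr' j)) hV hab (fun j => (√(r' j) : ℂ) * y j)
  have hy : (R * S * T) *ᵥ (fun j => (√(r' j) : ℂ) * y j) = R *ᵥ (S *ᵥ y) := by
    rw [← Matrix.mulVec_mulVec, ← Matrix.mulVec_mulVec]
    congr 2
    ext j
    rw [hT, Matrix.mulVec_diagonal, ← mul_assoc, ← Complex.ofReal_mul,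
      inv_mul_cancel₀ (hpos' j).ne']
    simp
  rw [hy] at h
  convert h using 2 with i _ j _
  · rw [hR, Matrix.mulVec_diagonal, norm_mul, mul_pow, Complex.norm_real, Real.norm_eq_abs,
      abs_of_pos (hpos i), Real.sq_sqrt (hr i).le]
    ring
  · rw [norm_mul, mul_pow, Complex.norm_real, Real.norm_eq_abs, abs_of_pos (hpos' j),
      Real.sq_sqrt (hr' j).le]
    ring

/-- Passing to inverses reverses `S* diag(p) S ≤ diag(q)` into
`S diag(q)⁻¹ S* ≤ diag(p)⁻¹`. -/
theorem Matrix.sum_inv_conjTranspose_mulVec_le {ι κ : Type*} [Fintype ι] [DecidableEq ι]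
    [Fintype κ] [DecidableEq κ]
    {p : ι → ℝ} {q : κ → ℝ} (hp : ∀ i, 0 < p i) (hq : ∀ j, 0 < q j) {S : Matrix ι κ ℂ}
    (hS : ∀ y, ∑ i, p i * ‖(S *ᵥ y) i‖ ^ 2 ≤ ∑ j, q j * ‖y j‖ ^ 2) (d : ι → ℂ) :
    ∑ j, (q j)⁻¹ * ‖(Sᴴ *ᵥ d) j‖ ^ 2 ≤ ∑ i, (p i)⁻¹ * ‖d i‖ ^ 2 := by
  -- expand `0 ≤ ∑ p |p⁻¹ d - S y|²` with `y = q⁻¹ S* d`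
  set y : κ → ℂ := fun j => ((q j)⁻¹ : ℝ) * (Sᴴ *ᵥ d) j with hy
  have h1 : ∀ i, p i * ‖((p i)⁻¹ : ℝ) * d i - (S *ᵥ y) i‖ ^ 2 =
      (p i)⁻¹ * ‖d i‖ ^ 2 - 2 * (star ((S *ᵥ y) i) * d i).re + p i * ‖(S *ᵥ y) i‖ ^ 2 := by
    intro i
    have := (hp i).ne'
    simp only [Complex.sq_norm, Complex.normSq_apply, Complex.sub_re, Complex.sub_im,
      Complex.star_def, Complex.mul_re, Complex.mul_im, Complex.ofReal_re, Complex.ofReal_im,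
      Complex.conj_re, Complex.conj_im]
    field_simp
    ring
  have h2 : ∑ i, star ((S *ᵥ y) i) * d i = (∑ j, (q j)⁻¹ * ‖(Sᴴ *ᵥ d) j‖ ^ 2 : ℝ) := by
    have : ∑ i, star ((S *ᵥ y) i) * d i = star (S *ᵥ y) ⬝ᵥ d := rfl
    rw [this, Matrix.star_mulVec, ← Matrix.dotProduct_mulVec, dotProduct, Complex.ofReal_sum]
    refine Finset.sum_congr rfl fun j _ => ?_
    have := Complex.conj_mul' ((Sᴴ *ᵥ d) j)
    rw [Complex.ofReal_mul, Complex.ofReal_pow, ← this, hy, Pi.star_apply]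
    simp
    ring
  have h3 : ∑ j, q j * ‖y j‖ ^ 2 = ∑ j, (q j)⁻¹ * ‖(Sᴴ *ᵥ d) j‖ ^ 2 := by
    refine Finset.sum_congr rfl fun j _ => ?_
    have := (hq j).ne'
    rw [hy, norm_mul, mul_pow, Complex.norm_real, Real.norm_eq_abs,
      abs_of_pos (inv_pos.2 (hq j))]
    field_simp
  have h4 : 0 ≤ ∑ i, p i * ‖((p i)⁻¹ : ℝ) * d i - (S *ᵥ y) i‖ ^ 2 :=
    Finset.sum_nonneg fun i _ => mul_nonneg (hp i).le (by positivity)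
  simp_rw [h1] at h4
  rw [Finset.sum_add_distrib, Finset.sum_sub_distrib, ← Finset.mul_sum, ← Complex.re_sum, h2,
    Complex.ofReal_re] at h4
  have h5 := hS y
  rw [h3] at h5
  linarith

/-! ### Partial trace -/

theorem partialTrace₂_add {n m : Type*} [Fintype m]
    (X Y : Matrix (n × m) (n × m) ℂ) :
    partialTrace₂ (X + Y) = partialTrace₂ X + partialTrace₂ Y := by
  ext i j
  simp [partialTrace₂, Finset.sum_add_distrib]

theorem partialTrace₂_sub {n m : Type*} [Fintype m]
    (X Y : Matrix (n × m) (n × m) ℂ) :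
    partialTrace₂ (X - Y) = partialTrace₂ X - partialTrace₂ Y := by
  ext i j
  simp [partialTrace₂]

theorem partialTrace₂_smul {n m : Type*} [Fintype m]
    (c : ℂ) (X : Matrix (n × m) (n × m) ℂ) :
    partialTrace₂ (c • X) = c • partialTrace₂ X := by
  ext i j
  simp [partialTrace₂, Finset.mul_sum]

theorem partialTrace₂_one {n m : Type*} [DecidableEq n] [Fintype m] [DecidableEq m] :
    partialTrace₂ (1 : Matrix (n × m) (n × m) ℂ) = (Fintype.card m : ℂ) • 1 := by
  ext i j
  by_cases h : i = j <;> simp [partialTrace₂, Matrix.one_apply, h]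

theorem partialTrace₂_kronecker_one_mul {n m : Type*} [Fintype n] [Fintype m] [DecidableEq m]
    (A : Matrix n n ℂ) (X : Matrix (n × m) (n × m) ℂ) :
    partialTrace₂ (A ⊗ₖ (1 : Matrix m m ℂ) * X) = A * partialTrace₂ X := by
  ext i j
  simp only [partialTrace₂, Matrix.of_apply, Matrix.mul_apply, Fintype.sum_prod_type,
    Matrix.kroneckerMap_apply, Matrix.one_apply, mul_ite, mul_one, mul_zero, ite_mul, zero_mul,
    Finset.sum_ite_eq, Finset.mem_univ, if_true, Finset.mul_sum]
  exact Finset.sum_comm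

theorem partialTrace₂_mul_kronecker_one {n m : Type*} [Fintype n] [Fintype m] [DecidableEq m]
    (A : Matrix n n ℂ) (X : Matrix (n × m) (n × m) ℂ) :
    partialTrace₂ (X * A ⊗ₖ (1 : Matrix m m ℂ)) = partialTrace₂ X * A := by
  ext i j
  simp only [partialTrace₂, Matrix.of_apply, Matrix.mul_apply, Fintype.sum_prod_type,
    Matrix.kroneckerMap_apply, Matrix.one_apply, mul_ite, mul_one, mul_zero,
    Finset.sum_ite_eq', Finset.mem_univ, if_true, Finset.sum_mul]
  exact Finset.sum_comm

/-- The partial trace over the second factor is cyclic for operators on that factor. -/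
theorem partialTrace₂_one_kronecker_mul {n m : Type*} [Fintype n] [DecidableEq n] [Fintype m]
    (B : Matrix m m ℂ) (X : Matrix (n × m) (n × m) ℂ) :
    partialTrace₂ ((1 : Matrix n n ℂ) ⊗ₖ B * X) = partialTrace₂ (X * (1 : Matrix n n ℂ) ⊗ₖ B) := by
  ext i j
  simp only [partialTrace₂, Matrix.of_apply, Matrix.mul_apply, Fintype.sum_prod_type_right,
    Matrix.kroneckerMap_apply, Matrix.one_apply, mul_ite, mul_zero, ite_mul, one_mul,
    zero_mul, Finset.sum_ite_eq, Finset.sum_ite_eq', Finset.mem_univ, if_true]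
  rw [Finset.sum_comm]
  simp only [mul_comm]

theorem partialTrace₂_commutator {n m : Type*} [Fintype n] [DecidableEq n]
    [Fintype m] [DecidableEq m]
    (H₁ : Matrix n n ℂ) (H₂ : Matrix m m ℂ)
    (X : Matrix (n × m) (n × m) ℂ) :
    partialTrace₂ ((H₁ ⊗ₖ (1 : Matrix m m ℂ) + (1 : Matrix n n ℂ) ⊗ₖ H₂) * X -
        X * (H₁ ⊗ₖ (1 : Matrix m m ℂ) + (1 : Matrix n n ℂ) ⊗ₖ H₂)) =
      H₁ * partialTrace₂ X - partialTrace₂ X * H₁ := by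
  rw [Matrix.add_mul, Matrix.mul_add, partialTrace₂_sub, partialTrace₂_add, partialTrace₂_add,
    partialTrace₂_one_kronecker_mul, partialTrace₂_kronecker_one_mul,
    partialTrace₂_mul_kronecker_one, add_sub_add_right_eq_sub]

theorem Matrix.exp_kronecker_one {n m : Type*} [Fintype n] [DecidableEq n]
    [Fintype m] [DecidableEq m]
    (A : Matrix n n ℂ) :
    NormedSpace.exp (A ⊗ₖ (1 : Matrix m m ℂ)) = NormedSpace.exp A ⊗ₖ (1 : Matrix m m ℂ) := by
  let φ : Matrix n n ℂ →+* Matrix (n × m) (n × m) ℂ :=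
    { toFun := fun A => A ⊗ₖ 1
      map_one' := Matrix.one_kronecker_one
      map_mul' := fun A B => by rw [← Matrix.mul_kronecker_mul, Matrix.one_mul]
      map_zero' := Matrix.zero_kronecker _
      map_add' := fun A B => Matrix.add_kronecker _ _ _ }
  have hφ : Continuous φ := by
    refine continuous_matrix fun i j => ?_
    change Continuous fun A : Matrix n n ℂ => A i.1 j.1 * (1 : Matrix m m ℂ) i.2 j.2
    fun_prop
  open scoped Matrix.Norms.Operator in exact (NormedSpace.map_exp φ hφ A).symm

theorem Matrix.exp_one_kronecker {n m : Type*} [Fintype n] [DecidableEq n]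
    [Fintype m] [DecidableEq m]
    (B : Matrix m m ℂ) :
    NormedSpace.exp ((1 : Matrix n n ℂ) ⊗ₖ B) = (1 : Matrix n n ℂ) ⊗ₖ NormedSpace.exp B := by
  let φ : Matrix m m ℂ →+* Matrix (n × m) (n × m) ℂ :=
    { toFun := fun B => 1 ⊗ₖ B
      map_one' := Matrix.one_kronecker_one
      map_mul' := fun A B => by rw [← Matrix.mul_kronecker_mul, Matrix.one_mul]
      map_zero' := Matrix.kronecker_zero _
      map_add' := fun A B => Matrix.kronecker_add _ _ _ }
  have hφ : Continuous φ := by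
    refine continuous_matrix fun i j => ?_
    change Continuous fun B : Matrix m m ℂ => (1 : Matrix n n ℂ) i.1 j.1 * B i.2 j.2
    fun_prop
  open scoped Matrix.Norms.Operator in exact (NormedSpace.map_exp φ hφ B).symm

theorem Matrix.exp_kronecker_one_add_one_kronecker {n m : Type*} [Fintype n] [DecidableEq n]
    [Fintype m] [DecidableEq m]
    (A : Matrix n n ℂ) (B : Matrix m m ℂ) :
    NormedSpace.exp (A ⊗ₖ (1 : Matrix m m ℂ) + (1 : Matrix n n ℂ) ⊗ₖ B) =
      NormedSpace.exp A ⊗ₖ (1 : Matrix m m ℂ) * (1 : Matrix n n ℂ) ⊗ₖ NormedSpace.exp B := by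
  rw [Matrix.exp_add_of_commute, Matrix.exp_kronecker_one, Matrix.exp_one_kronecker]
  simp [Commute, SemiconjBy, ← Matrix.mul_kronecker_mul]

/-- Covariance of the partial trace under the product dynamics. -/
theorem partialTrace₂_exp_mul_mul_exp {n m : Type*} [Fintype n] [DecidableEq n]
    [Fintype m] [DecidableEq m]
    (A : Matrix n n ℂ) (B : Matrix m m ℂ) (c : ℂ)
    (X : Matrix (n × m) (n × m) ℂ) :
    partialTrace₂
        (NormedSpace.exp (-c • (A ⊗ₖ (1 : Matrix m m ℂ) + (1 : Matrix n n ℂ) ⊗ₖ B)) * X *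
          NormedSpace.exp (c • (A ⊗ₖ (1 : Matrix m m ℂ) + (1 : Matrix n n ℂ) ⊗ₖ B))) =
      NormedSpace.exp (-c • A) * partialTrace₂ X * NormedSpace.exp (c • A) := by
  have hexp : NormedSpace.exp (c • B) * NormedSpace.exp (-c • B) = 1 := by
    rw [← Matrix.exp_add_of_commute _ _ (((Commute.refl B).smul_left c).smul_right (-c)),
      ← add_smul]
    simp [NormedSpace.exp_zero]
  have hsum : ∀ s : ℂ, s • (A ⊗ₖ (1 : Matrix m m ℂ) + (1 : Matrix n n ℂ) ⊗ₖ B) =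
      (s • A) ⊗ₖ (1 : Matrix m m ℂ) + (1 : Matrix n n ℂ) ⊗ₖ (s • B) := fun s => by
    rw [smul_add, Matrix.smul_kronecker, Matrix.kronecker_smul]
  have hcomm : ∀ (A' : Matrix n n ℂ) (B' : Matrix m m ℂ),
      A' ⊗ₖ (1 : Matrix m m ℂ) * (1 : Matrix n n ℂ) ⊗ₖ B' =
        (1 : Matrix n n ℂ) ⊗ₖ B' * A' ⊗ₖ (1 : Matrix m m ℂ) := fun A' B' => by
    simp [← Matrix.mul_kronecker_mul]
  rw [hsum, hsum, Matrix.exp_kronecker_one_add_one_kronecker,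
    Matrix.exp_kronecker_one_add_one_kronecker, hcomm (NormedSpace.exp (c • A)),
    ← Matrix.mul_assoc, partialTrace₂_mul_kronecker_one, Matrix.mul_assoc, Matrix.mul_assoc,
    partialTrace₂_kronecker_one_mul, partialTrace₂_one_kronecker_mul, Matrix.mul_assoc X,
    ← Matrix.mul_kronecker_mul, hexp, Matrix.one_mul, Matrix.one_kronecker_one, Matrix.mul_one,
    Matrix.mul_assoc]

/-! ### Monotonicity of the Morozova-Chentsov kernel under the partial trace -/

/-- The matrix of the superoperator `X ↦ Gᴴ (X ⊗ 1) G`, the adjoint of `d ↦ Tr₂ (G d Gᴴ)`, with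
matrices regarded as vectors indexed by pairs. -/
def conjAmpliation {n m N : Type*} [Fintype m]
    (G : Matrix (n × m) N ℂ) : Matrix (N × N) (n × n) ℂ :=
  ∑ k, (G.submatrix (·, k) id)ᴴ ⊗ₖ (G.submatrix (·, k) id)ᵀ

/-- The adjoint of `X ↦ Gᴴ (X ⊗ 1) G` is `d ↦ Tr₂ (G d Gᴴ)`. -/
theorem conjAmpliation_conjTranspose_mulVec {n m N : Type*} [Fintype m] [Fintype N]
    (G : Matrix (n × m) N ℂ) (d : Matrix N N ℂ)
    (p : n × n) :
    ((conjAmpliation G)ᴴ *ᵥ fun q => d q.1 q.2) p = partialTrace₂ (G * d * Gᴴ) p.1 p.2 := by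
  simp only [conjAmpliation, Matrix.mulVec, dotProduct, Matrix.conjTranspose_apply,
    Matrix.sum_apply, Matrix.kroneckerMap_apply, Matrix.submatrix_apply, Matrix.transpose_apply,
    partialTrace₂, Matrix.of_apply, Matrix.mul_apply, star_sum, Finset.sum_mul,
    Fintype.sum_prod_type, star_mul', star_star, id]
  rw [Finset.sum_congr rfl fun i _ => Finset.sum_comm, Finset.sum_comm]
  refine Finset.sum_congr rfl fun k _ => ?_
  rw [Finset.sum_comm]
  refine Finset.sum_congr rfl fun i _ => Finset.sum_congr rfl fun j _ => ?_
  ring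

/-- The superoperator `X ↦ A X B`, whose matrix is `A ⊗ Bᵀ`, compressed by `X ↦ Gᴴ (X ⊗ 1) G`. For
`G Gᴴ = 1` and one of `A`, `B` equal to `1`, only the terms `k = k'` survive, and they form a
partial trace. -/
theorem conjAmpliation_conjTranspose_mul_mul {n m N : Type*} [Fintype n] [Fintype m] [Fintype N]
    (G : Matrix (n × m) N ℂ) (A B : Matrix N N ℂ) :
    (conjAmpliation G)ᴴ * (A ⊗ₖ Bᵀ) * conjAmpliation G = ∑ k, ∑ k',
      ((G * A * Gᴴ).submatrix (·, k) (·, k')) ⊗ₖ ((G * B * Gᴴ).submatrix (·, k') (·, k))ᵀ := by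
  have h : ∀ (C : Matrix N N ℂ) (k k' : m), G.submatrix (·, k) id * C *
      (G.submatrix (·, k') id)ᴴ = (G * C * Gᴴ).submatrix (·, k) (·, k') := fun C k k' => rfl
  simp only [conjAmpliation, Matrix.conjTranspose_sum, Matrix.conjTranspose_kronecker,
    Matrix.conjTranspose_conjTranspose, Matrix.sum_mul, Matrix.mul_sum,
    ← Matrix.mul_kronecker_mul]
  rw [Finset.sum_comm]
  refine Finset.sum_congr rfl fun k _ => Finset.sum_congr rfl fun k' _ => ?_
  rw [← h, ← h, Matrix.transpose_mul, Matrix.transpose_mul, Matrix.mul_assoc _ Bᵀ]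
  rfl

theorem sum_submatrix_kronecker_one {n m : Type*} [Fintype m] [DecidableEq m]
    {n' : Type*} [DecidableEq n'] (X : Matrix (n × m) (n × m) ℂ) :
    ∑ k, ∑ k', X.submatrix (·, k) (·, k') ⊗ₖ
      ((1 : Matrix (n' × m) (n' × m) ℂ).submatrix (·, k') (·, k))ᵀ =
        partialTrace₂ X ⊗ₖ (1 : Matrix n' n' ℂ) := by
  ext ⟨a, b⟩ ⟨c, d⟩
  by_cases h : b = d <;>
    simp [Matrix.sum_apply, partialTrace₂, Matrix.one_apply, h]

theorem sum_one_kronecker_submatrix {n m : Type*} [Fintype m] [DecidableEq m]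
    {n' : Type*} [DecidableEq n'] (X : Matrix (n × m) (n × m) ℂ) :
    ∑ k, ∑ k', (1 : Matrix (n' × m) (n' × m) ℂ).submatrix (·, k) (·, k') ⊗ₖ
      (X.submatrix (·, k') (·, k))ᵀ = (1 : Matrix n' n' ℂ) ⊗ₖ (partialTrace₂ X)ᵀ := by
  ext ⟨a, b⟩ ⟨c, d⟩
  by_cases h : a = c <;>
    simp [Matrix.sum_apply, partialTrace₂, Matrix.one_apply, h]

theorem Matrix.diagonal_fst_eq_kronecker {N : Type*} [DecidableEq N]
    (v : N → ℂ) :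
    (Matrix.diagonal fun q : N × N => v q.1) = Matrix.diagonal v ⊗ₖ (1 : Matrix N N ℂ) := by
  rw [← Matrix.diagonal_one, Matrix.diagonal_kronecker_diagonal]
  simp only [mul_one]

theorem Matrix.diagonal_snd_eq_kronecker {N : Type*} [DecidableEq N]
    (v : N → ℂ) :
    (Matrix.diagonal fun q : N × N => v q.2) =
      (1 : Matrix N N ℂ) ⊗ₖ (Matrix.diagonal v)ᵀ := by
  rw [Matrix.diagonal_transpose, ← Matrix.diagonal_one, Matrix.diagonal_kronecker_diagonal]
  simp only [one_mul]

theorem morozovaChentsov_of_ne_zero {f : ℝ → ℝ} {x y : ℝ} (hy : y ≠ 0) :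
    morozovaChentsov f x y = (y * f (x / y))⁻¹ := if_neg hy

/-- Petz's monotonicity theorem for the partial trace, for positive definite matrices written in
their eigenbases. -/
theorem IsStandardOperatorMonotone.sum_morozovaChentsov_partialTrace₂_le
    {n m N : Type*} [Fintype n] [DecidableEq n] [Fintype m] [DecidableEq m]
    [Fintype N] [DecidableEq N] {f : ℝ → ℝ}
    (hf : IsStandardOperatorMonotone f) {G : Matrix (n × m) N ℂ} (hG : G * Gᴴ = 1)
    {a : N → ℝ} {b : n → ℝ} (ha : ∀ i, 0 < a i) (hb : ∀ i, 0 < b i)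
    (hab : partialTrace₂ (G * (Matrix.diagonal fun i => (a i : ℂ)) * Gᴴ) =
      Matrix.diagonal fun i => (b i : ℂ))
    (d : Matrix N N ℂ) :
    ∑ p : n × n, morozovaChentsov f (b p.1) (b p.2) *
        ‖partialTrace₂ (G * d * Gᴴ) p.1 p.2‖ ^ 2 ≤
      ∑ q : N × N, morozovaChentsov f (a q.1) (a q.2) * ‖d q.1 q.2‖ ^ 2 := by
  have hl : (conjAmpliation G)ᴴ * (Matrix.diagonal fun q : N × N => (a q.1 : ℂ)) *
      conjAmpliation G = Matrix.diagonal fun p : n × n => (b p.1 : ℂ) := by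
    rw [Matrix.diagonal_fst_eq_kronecker fun i => (a i : ℂ),
      Matrix.diagonal_fst_eq_kronecker fun i => (b i : ℂ), ← hab,
      ← Matrix.transpose_one (n := N), conjAmpliation_conjTranspose_mul_mul, Matrix.mul_one, hG,
      sum_submatrix_kronecker_one]
  have hr : (conjAmpliation G)ᴴ * (Matrix.diagonal fun q : N × N => (a q.2 : ℂ)) *
      conjAmpliation G = Matrix.diagonal fun p : n × n => (b p.2 : ℂ) := by
    rw [Matrix.diagonal_snd_eq_kronecker fun i => (a i : ℂ),
      Matrix.diagonal_snd_eq_kronecker fun i => (b i : ℂ), ← hab,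
      conjAmpliation_conjTranspose_mul_mul, Matrix.mul_one, hG, sum_one_kronecker_submatrix]
  have h := Matrix.sum_inv_conjTranspose_mulVec_le
    (p := fun q : N × N => a q.2 * f (a q.1 / a q.2))
    (q := fun p : n × n => b p.2 * f (b p.1 / b p.2))
    (fun q => mul_pos (ha _) (hf.pos (div_pos (ha _) (ha _))))
    (fun q => mul_pos (hb _) (hf.pos (div_pos (hb _) (hb _))))
    (hf.sum_mean_le (l := fun q : N × N => a q.1) (r := fun q : N × N => a q.2)
      (l' := fun p : n × n => b p.1) (r' := fun p : n × n => b p.2) (fun q => ha q.1)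
      (fun q => ha q.2) (fun p => hb p.1) (fun p => hb p.2) hl hr)
    (fun q => d q.1 q.2)
  simp_rw [conjAmpliation_conjTranspose_mulVec] at h
  simp_rw [fun i j => morozovaChentsov_of_ne_zero (f := f) (x := b i) (hb j).ne',
    fun i j => morozovaChentsov_of_ne_zero (f := f) (x := a i) (ha j).ne']
  exact h

/-- If `f 0 > 0`, the Morozova-Chentsov function is continuous along the diagonal direction at
every point of the closed quadrant except the origin. -/
theorem IsStandardOperatorMonotone.tendsto_morozovaChentsov {f : ℝ → ℝ}
    (hf : IsStandardOperatorMonotone f) (hf0 : 0 < f 0) {x y s : ℝ} (hx : 0 ≤ x) (hy : 0 ≤ y)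
    (hs : 0 < s) (hxy : x = 0 → y ≠ 0) :
    Tendsto (fun ε => morozovaChentsov f (x + s * ε) (y + s * ε)) (𝓝[>] 0)
      (𝓝 (morozovaChentsov f x y)) := by
  -- the case `0 < y`, without reference to the value of `c` on the axes
  have main : ∀ x y : ℝ, 0 ≤ x → 0 < y →
      Tendsto (fun ε => ((y + s * ε) * f ((x + s * ε) / (y + s * ε)))⁻¹) (𝓝[>] 0)
        (𝓝 (y * f (x / y))⁻¹) := by
    intro x y hx hy
    have h0 : ∀ z : ℝ, Tendsto (fun ε => z + s * ε) (𝓝[>] 0) (𝓝 z) := fun z => by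
      have : ContinuousAt (fun ε => z + s * ε) 0 := by fun_prop
      have h := this.tendsto
      simp only [mul_zero, add_zero] at h
      exact h.mono_left nhdsWithin_le_nhds
    have hfpos : 0 < f (x / y) := hf0.trans_le (hf.monotoneOn le_rfl (div_nonneg hx hy.le))
    have hq : Tendsto (fun ε => (x + s * ε) / (y + s * ε)) (𝓝[>] 0)
        (𝓝[Set.Ici 0] (x / y)) := by
      refine tendsto_nhdsWithin_iff.2 ⟨(h0 x).div (h0 y) hy.ne', ?_⟩
      filter_upwards [self_mem_nhdsWithin] with ε hε
      have : (0 : ℝ) < ε := hε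
      exact Set.mem_Ici.2 (by positivity)
    exact ((h0 y).mul ((hf.continuousWithinAt (div_nonneg hx hy.le)).tendsto.comp hq)).inv₀
      (mul_pos hy hfpos).ne'
  rcases hy.eq_or_lt with rfl | hy
  · have hx : 0 < x := hx.lt_of_ne fun h => hxy h.symm rfl
    have h := main 0 x le_rfl hx
    rw [zero_div] at h
    rw [morozovaChentsov, if_pos rfl]
    refine h.congr' ?_
    filter_upwards [self_mem_nhdsWithin] with ε hε
    have hε : (0 : ℝ) < ε := hε
    have h1 : 0 < 0 + s * ε := by positivity
    have h2 : 0 < x + s * ε := by positivity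
    -- the symmetry of `f` is the symmetry of `c`
    rw [morozovaChentsov_of_ne_zero h1.ne', hf.symm _ (div_pos h1 h2), one_div_div]
    congr 1
    field_simp
  · rw [morozovaChentsov_of_ne_zero hy.ne']
    refine (main x y hx hy).congr' ?_
    filter_upwards [self_mem_nhdsWithin] with ε hε
    have hε : (0 : ℝ) < ε := hε
    rw [morozovaChentsov_of_ne_zero (by positivity)]

/-- Petz's monotonicity theorem for the partial trace and `f 0 ≠ 0`. The matrices may be singular,
but the arguments of the quadratic forms must have no component at the eigenvalue pair
`(0, 0)`. -/
theorem IsStandardOperatorMonotone.sum_morozovaChentsov_partialTrace₂_le_of_nonneg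
    {n m N : Type*} [Fintype n] [DecidableEq n] [Fintype m] [DecidableEq m]
    [Fintype N] [DecidableEq N]
    {f : ℝ → ℝ}
    (hf : IsStandardOperatorMonotone f) (hf0 : 0 < f 0) [Nonempty m]
    {G : Matrix (n × m) N ℂ} (hG : G * Gᴴ = 1)
    {a : N → ℝ} {b : n → ℝ} (ha : ∀ i, 0 ≤ a i) (hb : ∀ i, 0 ≤ b i)
    (hab : partialTrace₂ (G * (Matrix.diagonal fun i => (a i : ℂ)) * Gᴴ) =
      Matrix.diagonal fun i => (b i : ℂ))
    {d : Matrix N N ℂ} (hd : ∀ i j, a i = 0 → a j = 0 → d i j = 0)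
    (hd' : ∀ i j, b i = 0 → b j = 0 → partialTrace₂ (G * d * Gᴴ) i j = 0) :
    ∑ p : n × n, morozovaChentsov f (b p.1) (b p.2) *
        ‖partialTrace₂ (G * d * Gᴴ) p.1 p.2‖ ^ 2 ≤
      ∑ q : N × N, morozovaChentsov f (a q.1) (a q.2) * ‖d q.1 q.2‖ ^ 2 := by
  have hm : (0 : ℝ) < Fintype.card m := by exact_mod_cast Fintype.card_pos
  have hterm : ∀ (x y s : ℝ) (z : ℂ), 0 ≤ x → 0 ≤ y → 0 < s → (x = 0 → y = 0 → z = 0) →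
      Tendsto (fun ε => morozovaChentsov f (x + s * ε) (y + s * ε) * ‖z‖ ^ 2) (𝓝[>] 0)
        (𝓝 (morozovaChentsov f x y * ‖z‖ ^ 2)) := by
    intro x y s z hx hy hs hz
    by_cases h : x = 0 ∧ y = 0
    · simp [hz h.1 h.2]
    · exact (hf.tendsto_morozovaChentsov hf0 hx hy hs fun h1 h2 => h ⟨h1, h2⟩).mul_const _
  -- replacing `ρ` by `ρ + ε` makes the reduced matrix `ρ₁ + (card m) ε` and changes no eigenvector
  refine le_of_tendsto_of_tendsto
    (tendsto_finsetSum _ fun p _ => hterm (b p.1) (b p.2) (Fintype.card m) _ (hb _) (hb _) hm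
      (hd' _ _))
    (tendsto_finsetSum _ fun q _ => hterm (a q.1) (a q.2) 1 _ (ha _) (ha _) one_pos (hd _ _)) ?_
  filter_upwards [self_mem_nhdsWithin] with ε hε
  have hε : (0 : ℝ) < ε := hε
  refine hf.sum_morozovaChentsov_partialTrace₂_le (a := fun i => a i + 1 * ε)
    (b := fun i => b i + Fintype.card m * ε) hG
    (fun i => add_pos_of_nonneg_of_pos (ha i) (by positivity))
    (fun i => add_pos_of_nonneg_of_pos (hb i) (by positivity)) ?_ d
  have h1 : (Matrix.diagonal fun i => ((a i + 1 * ε : ℝ) : ℂ)) =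
      (Matrix.diagonal fun i => (a i : ℂ)) + (ε : ℂ) • 1 := by
    rw [Matrix.smul_one_eq_diagonal, Matrix.diagonal_add]; simp
  rw [h1, Matrix.mul_add, Matrix.add_mul, partialTrace₂_add, hab, Matrix.mul_smul,
    Matrix.mul_one, Matrix.smul_mul, hG, partialTrace₂_smul, partialTrace₂_one, smul_smul,
    Matrix.smul_one_eq_diagonal, Matrix.diagonal_add]
  congr 1; ext i; push_cast; ring

/-! ### Skew information -/

theorem Matrix.IsHermitian.eigenvectorUnitary_conj {n : Type*} [Fintype n] [DecidableEq n]
    {A : Matrix n n ℂ} (hA : A.IsHermitian) :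
    (hA.eigenvectorUnitary : Matrix n n ℂ)ᴴ * A * hA.eigenvectorUnitary =
      Matrix.diagonal fun i => (hA.eigenvalues i : ℂ) := by
  have h := hA.conjStarAlgAut_star_eigenvectorUnitary
  simpa [Unitary.conjStarAlgAut_apply, Matrix.star_eq_conjTranspose, Function.comp_def] using h

theorem Matrix.IsHermitian.eigenvectorUnitary_mul_conjTranspose
    {n : Type*} [Fintype n] [DecidableEq n]
    {A : Matrix n n ℂ}
    (hA : A.IsHermitian) :
    (hA.eigenvectorUnitary : Matrix n n ℂ) * (hA.eigenvectorUnitary : Matrix n n ℂ)ᴴ = 1 :=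
  Unitary.mul_star_self_of_mem hA.eigenvectorUnitary.2

theorem Matrix.IsHermitian.eigenvectorUnitary_conjTranspose_mul
    {n : Type*} [Fintype n] [DecidableEq n]
    {A : Matrix n n ℂ}
    (hA : A.IsHermitian) :
    (hA.eigenvectorUnitary : Matrix n n ℂ)ᴴ * (hA.eigenvectorUnitary : Matrix n n ℂ) = 1 :=
  Unitary.star_mul_self_of_mem hA.eigenvectorUnitary.2

/-- The entries of `i[H, A]` in an eigenbasis of `A` vanish at pairs of equal eigenvalues. -/
theorem Matrix.IsHermitian.commutator_apply_eq_zero {n : Type*} [Fintype n] [DecidableEq n]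
    {A : Matrix n n ℂ} (hA : A.IsHermitian)
    (H : Matrix n n ℂ) {i j : n} (hij : hA.eigenvalues i = hA.eigenvalues j) :
    ((hA.eigenvectorUnitary : Matrix n n ℂ)ᴴ * (Complex.I • (H * A - A * H)) *
      hA.eigenvectorUnitary) i j = 0 := by
  set U := (hA.eigenvectorUnitary : Matrix n n ℂ)
  have hUU : U * Uᴴ = 1 := hA.eigenvectorUnitary_mul_conjTranspose
  have h : Uᴴ * (H * A - A * H) * U =
      (Uᴴ * H * U) * (Uᴴ * A * U) - (Uᴴ * A * U) * (Uᴴ * H * U) := by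
    have h1 : ∀ X Y : Matrix n n ℂ, (Uᴴ * X * U) * (Uᴴ * Y * U) = Uᴴ * (X * Y) * U := by
      intro X Y
      calc (Uᴴ * X * U) * (Uᴴ * Y * U) = Uᴴ * X * (U * Uᴴ) * Y * U := by
            simp only [Matrix.mul_assoc]
        _ = Uᴴ * (X * Y) * U := by rw [hUU, Matrix.mul_one]; simp only [Matrix.mul_assoc]
    rw [h1, h1, Matrix.mul_sub, Matrix.sub_mul]
  rw [Matrix.mul_smul, Matrix.smul_mul, h, hA.eigenvectorUnitary_conj, Matrix.smul_apply,
    Matrix.sub_apply, Matrix.mul_diagonal, Matrix.diagonal_mul, hij]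
  simp [mul_comm]

theorem Matrix.IsHermitian.I_smul_commutator {n : Type*} [Fintype n]
    {A H : Matrix n n ℂ} (hA : A.IsHermitian)
    (hH : H.IsHermitian) : (Complex.I • (H * A - A * H)).IsHermitian := by
  rw [Matrix.IsHermitian, Matrix.conjTranspose_smul, Matrix.conjTranspose_sub,
    Matrix.conjTranspose_mul, Matrix.conjTranspose_mul, hA.eq, hH.eq]
  simp only [Complex.star_def, Complex.conj_I, neg_smul, ← smul_neg, neg_sub]

/-- The skew information as a sum over the pairs of eigenvalues, weighted with the entries of
`i[H, ρ]` in an eigenbasis of `ρ`. -/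
theorem skewInformation_eq_sum {n : Type*} [Fintype n] [DecidableEq n]
    (f : ℝ → ℝ) (ρ : QState n) {H : Matrix n n ℂ}
    (hH : H.IsHermitian) :
    skewInformation f ρ H = f 0 / 2 * ∑ p : n × n,
      morozovaChentsov f (ρ.posSemidef.isHermitian.eigenvalues p.1)
          (ρ.posSemidef.isHermitian.eigenvalues p.2) *
        ‖((ρ.posSemidef.isHermitian.eigenvectorUnitary : Matrix n n ℂ)ᴴ *
          (Complex.I • (H * ρ.mat - ρ.mat * H)) *
            ρ.posSemidef.isHermitian.eigenvectorUnitary) p.1 p.2‖ ^ 2 := by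
  have hρ := ρ.posSemidef.isHermitian
  have hD := hρ.I_smul_commutator hH
  simp only [skewInformation, leftRightCalculus]
  set D : Matrix n n ℂ := Complex.I • (H * ρ.mat - ρ.mat * H)
  set U := (ρ.posSemidef.isHermitian.eigenvectorUnitary : Matrix n n ℂ)
  have hE : ∀ i j, (Uᴴ * D * U) i j = star ((Uᴴ * D * U) j i) := fun i j =>
    ((Matrix.isHermitian_conjTranspose_mul_mul U hD).apply i j).symm
  congr 1
  rw [← Matrix.mul_assoc, Matrix.trace_mul_comm, ← Matrix.mul_assoc, ← Matrix.mul_assoc,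
    Matrix.trace_mul_comm, Matrix.trace, Fintype.sum_prod_type, Complex.re_sum]
  refine Finset.sum_congr rfl fun i _ => ?_
  rw [Matrix.diag_apply, Matrix.mul_apply, Complex.re_sum]
  refine Finset.sum_congr rfl fun j _ => ?_
  rw [Matrix.of_apply, hE j i, mul_assoc, Complex.star_def, Complex.mul_conj',
    Complex.re_ofReal_mul]
  norm_cast

/-- The skew information does not increase under the partial trace, for every pair of observables
for which the partial trace maps `[H, ρ]` to `[H₁, ρ₁]`. -/
theorem skewInformation_reduced₁_le {n m : Type*} [Fintype n] [DecidableEq n]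
    [Fintype m] [DecidableEq m]
    {f : ℝ → ℝ} (hf : IsStandardOperatorMonotone f)
    (ρ : QState (n × m)) {H : Matrix (n × m) (n × m) ℂ} (hH : H.IsHermitian)
    {H₁ : Matrix n n ℂ} (hH₁ : H₁.IsHermitian)
    (hcomm : partialTrace₂ (H * ρ.mat - ρ.mat * H) =
      H₁ * partialTrace₂ ρ.mat - partialTrace₂ ρ.mat * H₁) :
    skewInformation f ρ.reduced₁ H₁ ≤ skewInformation f ρ H := by
  rcases hf.map_zero_nonneg.eq_or_lt with hf0 | hf0
  · simp [skewInformation, ← hf0]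
  -- a state of trace one does not exist on the zero space
  have hm : Nonempty m := by
    by_contra h
    rw [not_nonempty_iff] at h
    simpa [Matrix.trace] using ρ.trace_eq_one
  rw [skewInformation_eq_sum f ρ hH, skewInformation_eq_sum f ρ.reduced₁ hH₁]
  refine mul_le_mul_of_nonneg_left ?_ (by positivity)
  have hρ := ρ.posSemidef.isHermitian
  have hσ := ρ.reduced₁.posSemidef.isHermitian
  have hd := fun i j (h : ρ.posSemidef.isHermitian.eigenvalues i = 0)
    (h' : ρ.posSemidef.isHermitian.eigenvalues j = 0) =>
    ρ.posSemidef.isHermitian.commutator_apply_eq_zero H (h.trans h'.symm)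
  have hd' := fun i j (h : ρ.reduced₁.posSemidef.isHermitian.eigenvalues i = 0)
    (h' : ρ.reduced₁.posSemidef.isHermitian.eigenvalues j = 0) =>
    ρ.reduced₁.posSemidef.isHermitian.commutator_apply_eq_zero H₁ (h.trans h'.symm)
  have hUD := hρ.eigenvectorUnitary_conj
  have hWD := hσ.eigenvectorUnitary_conj
  have hUU := hρ.eigenvectorUnitary_mul_conjTranspose
  have hWW := hσ.eigenvectorUnitary_conjTranspose_mul
  set U := (ρ.posSemidef.isHermitian.eigenvectorUnitary : Matrix (n × m) (n × m) ℂ)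
  set W := (ρ.reduced₁.posSemidef.isHermitian.eigenvectorUnitary : Matrix n n ℂ)
  -- `G` passes from the eigenbasis of `ρ` to the basis that diagonalizes the reduced state
  set G : Matrix (n × m) (n × m) ℂ := Wᴴ ⊗ₖ (1 : Matrix m m ℂ) * U with hG
  have hGX : ∀ X, partialTrace₂ (G * (Uᴴ * X * U) * Gᴴ) = Wᴴ * partialTrace₂ X * W := by
    intro X
    have h : G * (Uᴴ * X * U) * Gᴴ =
        Wᴴ ⊗ₖ (1 : Matrix m m ℂ) * ((U * Uᴴ) * X * (U * Uᴴ)) * W ⊗ₖ (1 : Matrix m m ℂ) := by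
      rw [hG, Matrix.conjTranspose_mul, Matrix.conjTranspose_kronecker,
        Matrix.conjTranspose_conjTranspose, Matrix.conjTranspose_one]
      simp only [Matrix.mul_assoc]
    rw [h, hUU, Matrix.one_mul, Matrix.mul_one, partialTrace₂_mul_kronecker_one,
      partialTrace₂_kronecker_one_mul]
  have hGG : G * Gᴴ = 1 := by
    rw [hG, Matrix.conjTranspose_mul, Matrix.mul_assoc, ← Matrix.mul_assoc U, hUU,
      Matrix.one_mul, Matrix.conjTranspose_kronecker, Matrix.conjTranspose_conjTranspose,
      Matrix.conjTranspose_one, ← Matrix.mul_kronecker_mul, hWW, Matrix.one_mul,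
      Matrix.one_kronecker_one]
  have hab : partialTrace₂ (G * (Matrix.diagonal fun i =>
      (ρ.posSemidef.isHermitian.eigenvalues i : ℂ)) * Gᴴ) =
        Matrix.diagonal fun i => (ρ.reduced₁.posSemidef.isHermitian.eigenvalues i : ℂ) := by
    rw [← hUD, hGX]
    exact hWD
  have hGD : partialTrace₂ (G * (Uᴴ * (Complex.I • (H * ρ.mat - ρ.mat * H)) * U) * Gᴴ) =
      Wᴴ * (Complex.I • (H₁ * ρ.reduced₁.mat - ρ.reduced₁.mat * H₁)) * W := by
    rw [hGX, partialTrace₂_smul, hcomm]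
    rfl
  rw [← hGD] at hd' ⊢
  exact hf.sum_morozovaChentsov_partialTrace₂_le_of_nonneg hf0 hGG
    ρ.posSemidef.eigenvalues_nonneg ρ.reduced₁.posSemidef.eigenvalues_nonneg hab hd hd'

theorem mainTheorem3 {n m : Type*} [Fintype n] [DecidableEq n] [Fintype m] [DecidableEq m]
    (f : ℝ → ℝ) (hf : IsStandardOperatorMonotone f) (ρ : QState (n × m))
    (H₁ : Matrix n n ℂ) (hH₁ : H₁.IsHermitian) (H₂ : Matrix m m ℂ) (hH₂ : H₂.IsHermitian) :
    skewInformation f ρ.reduced₁ H₁ ≤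
        skewInformation f ρ (H₁ ⊗ₖ (1 : Matrix m m ℂ) + (1 : Matrix n n ℂ) ⊗ₖ H₂) ∧
      skewInformation f ρ.reduced₁ H₁ ≤ skewInformation f ρ (H₁ ⊗ₖ (1 : Matrix m m ℂ)) ∧
      ∀ (t : ℝ) (X : Matrix (n × m) (n × m) ℂ),
        partialTrace₂
            (NormedSpace.exp (-(Complex.I * t) •
                (H₁ ⊗ₖ (1 : Matrix m m ℂ) + (1 : Matrix n n ℂ) ⊗ₖ H₂)) * X *
              NormedSpace.exp ((Complex.I * t) •
                (H₁ ⊗ₖ (1 : Matrix m m ℂ) + (1 : Matrix n n ℂ) ⊗ₖ H₂))) =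
          NormedSpace.exp (-(Complex.I * t) • H₁) * partialTrace₂ X *
            NormedSpace.exp ((Complex.I * t) • H₁) := by
  have key : ∀ K : Matrix m m ℂ, K.IsHermitian → skewInformation f ρ.reduced₁ H₁ ≤
      skewInformation f ρ (H₁ ⊗ₖ (1 : Matrix m m ℂ) + (1 : Matrix n n ℂ) ⊗ₖ K) := by
    intro K hK
    refine skewInformation_reduced₁_le hf ρ (Matrix.IsHermitian.add ?_ ?_) hH₁
      (partialTrace₂_commutator H₁ K ρ.mat)
    · rw [Matrix.IsHermitian, Matrix.conjTranspose_kronecker, hH₁.eq, Matrix.conjTranspose_one]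
    · rw [Matrix.IsHermitian, Matrix.conjTranspose_kronecker, hK.eq, Matrix.conjTranspose_one]
  refine ⟨key H₂ hH₂, ?_, fun t X => partialTrace₂_exp_mul_mul_exp H₁ H₂ _ X⟩
  -- the second inequality is the case `H₂ = 0`
  simpa using key 0 Matrix.isHermitian_zero
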